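/- Let $\sigma>0$, let $\phi_1,\dots,\phi_k:\mathbb R\to(-\infty,+\infty]$ be measurable cost functions and $\Gamma=(\Gamma_1,\dots,\Gamma_k)\in\mathbb R^k$. For $n\ge 1$ let $$\mathcal S_n=\Big\{x\in\mathbb R^n:\ \sum_{t=1}^n\phi_j(x_t)\le n\Gamma_j,\ j=1,\dots,k\Big\},$$ and assume $0<\mathrm{Vol}(\mathcal S_n)<\infty$ for all sufficiently large $n$. Consider the memoryless Gaussian channel $Y_t=X_t+Z_t$, where the $Z_t$ are i.i.d. $\mathcal N(0,\sigma^2)$ and independent of the input, and let $$C(\Gamma)=\liminf_{n\to\infty}\ \sup\ \tfrac1n I(X_1,\dots,X_n;Y_1,\dots,Y_n),$$ the supremum being over all laws of $(X_1,\dots,X_n)$ concentrated on $\mathcal S_n$ (natural logarithms; all quantities may take infinite values). Let $\mathbb R_+^k$ be the set of vectors with strictly positive components, and for $\theta\in\mathbb R_+^k$ put $\theta\cdot\Gamma=\sum_j\theta_j\Gamma_j$, $\theta\cdot\phi(x)=\sum_j\theta_j\phi_j(x)$ and $$\zeta_\theta(y)=\int_{\mathbb R}\frac{\exp\{-\theta\cdot\phi(x)-(y-x)^2/(2\sigma^2)\}}{\sqrt{2\pi\sigma^2}}\,dx\in[0,\infty].$$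 Let $X^{(n)}$ denote a single component of a random vector uniformly distributed on $\mathcal S_n$, and $Y^{(n)}=X^{(n)}+Z$ with $Z\sim\mathcal N(0,\sigma^2)$ independent of $X^{(n)}$. Expectations $\mathbb E f=\mathbb E f^+-\mathbb E f^-$ are extended-real-valued, and are $+\infty$ if $\mathbb E f^+=\infty$; likewise a difference of the form $\infty-\infty$ in the lower bounds below is read as $-\infty$. Then: 1. The volume exponent $v(\Gamma)=\lim_{n\to\infty}\frac1n\log\mathrm{Vol}(\mathcal S_n)$ exists in $(-\infty,+\infty]$. 2. $$C(\Gamma)\ \ge\ v(\Gamma)-\tfrac12\log(2\pi e\sigma^2)-\inf_{\theta\in\mathbb R_+^k}\Big(\theta\cdot\Gamma+\limsup_{n\to\infty}\mathbb E\log\zeta_\theta(Y^{(n)})\Big).$$ 3. Suppose that $X^{(n)}$ converges in distribution to a random variable $X$ (the asymptotic single-letter input), and let $Y=X+Z$ with $Z\sim\mathcal N(0,\sigma^2)$ independent of $X$ (the single-letter output). Then $$C(\Gamma)\ \ge\ v(\Gamma)-\tfrac12\log(2\pi e\sigma^2)-\inf_{\theta}\Big(\theta\cdot\Gamma+\mathbb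 E\log\zeta_\theta(Y)\Big),$$ where the infimum is over all $\theta\in\mathbb R_+^k$ for which the positive parts of $\log\zeta_\theta(Y^{(n)})$ are asymptotically uniformly integrable, i.e. for every $\varepsilon>0$ there is a $K$ with $\mathbb E(\log\zeta_\theta(Y^{(n)})-K)^+\le\varepsilon$ for all large $n$. (Remark: this condition is automatic whenever $\zeta_\theta$ is bounded, e.g. if $\int_{\mathbb R} e^{-\theta\cdot\phi(x)}dx<\infty$; if all $\phi_j$ are bounded below, it holds for every $\theta\in\mathbb R_+^k$, and the infimum is over all of $\mathbb R_+^k$.) -/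

import Mathlib

open MeasureTheory ProbabilityTheory Filter Topology
open scoped ENNReal NNReal BoundedContinuousFunction

namespace GaussCap

noncomputable section

/-- The set `S_n` of admissible input vectors: `∑ t, φ j (x t) ≤ n Γ j` for every `j`.
Cost functions may take the value `+∞` (they will be assumed never to be `-∞`). -/
def inputSet {k : ℕ} (φ : Fin k → ℝ → EReal) (Γ : Fin k → ℝ) (n : ℕ) : Set (Fin n → ℝ) :=
  {x | ∀ j, ∑ t, φ j (x t) ≤ (((n : ℝ) * Γ j : ℝ) : EReal)}

/-- The noise law: `N(0, σ²)` i.i.d. on `n` coordinates. -/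
def noise (σ : ℝ) (n : ℕ) : Measure (Fin n → ℝ) :=
  Measure.pi fun _ => gaussianReal 0 (Real.toNNReal (σ ^ 2))

/-- The mutual information of a pair of random elements with joint law `ρ`
(in nats; possibly infinite): divergence of `ρ` from the product of its marginals. -/
def mutualInfo {α β : Type*} [MeasurableSpace α] [MeasurableSpace β]
    (ρ : Measure (α × β)) : ℝ≥0∞ :=
  InformationTheory.klDiv ρ (ρ.fst.prod ρ.snd)

/-- Joint law of channel input `X ∼ q` and channel output `Y = X + Z`, `Z` independent of `X`. -/
def channelJoint (σ : ℝ) (n : ℕ) (q : Measure (Fin n → ℝ)) :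
    Measure ((Fin n → ℝ) × (Fin n → ℝ)) :=
  (q.prod (noise σ n)).map fun p => (p.1, p.1 + p.2)

/-- `C_n(Γ)`: supremum of `I(X;Y)/n` over all input laws concentrated on `S_n`. -/
def blockCapacity {k : ℕ} (σ : ℝ) (φ : Fin k → ℝ → EReal) (Γ : Fin k → ℝ) (n : ℕ) : ℝ≥0∞ :=
  ⨆ (q : Measure (Fin n → ℝ)) (_ : IsProbabilityMeasure q) (_ : q (inputSet φ Γ n)ᶜ = 0),
    mutualInfo (channelJoint σ n q) / n

/-- The capacity `C(Γ) = liminf C_n(Γ)`. -/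
def capacity {k : ℕ} (σ : ℝ) (φ : Fin k → ℝ → EReal) (Γ : Fin k → ℝ) : ℝ≥0∞ :=
  liminf (fun n => blockCapacity σ φ Γ n) atTop

/-- `log Vol(S_n) / n`, in the extended reals (`log 0 = -∞`). -/
def volumeRate {k : ℕ} (φ : Fin k → ℝ → EReal) (Γ : Fin k → ℝ) (n : ℕ) : EReal :=
  ENNReal.log (volume (inputSet φ Γ n)) / ((n : ℝ) : EReal)

/-- The volume exponent `v(Γ)`. The limit inferior is total; that it is
a genuine limit is part of the main statement. -/
def volumeExponent {k : ℕ} (φ : Fin k → ℝ → EReal) (Γ : Fin k → ℝ) : EReal :=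
  liminf (fun n => volumeRate φ Γ n) atTop

/-- Law of a single component of `X` uniform on `S_{n+1}`
(by symmetry all components have the same law). -/
def inputMarginal {k : ℕ} (φ : Fin k → ℝ → EReal) (Γ : Fin k → ℝ) (n : ℕ) : Measure ℝ :=
  (ProbabilityTheory.cond volume (inputSet φ Γ (n + 1))).map fun x => x 0

/-- Law of the single-letter output `X + Z`, with `X ∼ μ` and `Z ∼ N(0, σ²)` independent. -/
def outputLaw (σ : ℝ) (μ : Measure ℝ) : Measure ℝ :=
  (μ.prod (gaussianReal 0 (Real.toNNReal (σ ^ 2)))).map fun p => p.1 + p.2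

/-- `μ` is the asymptotic law of a single component of the uniform input:
the single-component laws converge to `μ` weakly (in distribution). -/
def IsAsymptoticMarginal {k : ℕ} (φ : Fin k → ℝ → EReal) (Γ : Fin k → ℝ)
    (μ : Measure ℝ) : Prop :=
  ∀ f : ℝ →ᵇ ℝ, Tendsto (fun n => ∫ x, f x ∂(inputMarginal φ Γ n)) atTop (𝓝 (∫ x, f x ∂μ))

/-- `ζ_θ(y) = ∫ exp(-θ·φ(x) - (y-x)²/(2σ²)) dx / √(2πσ²)`. -/
def zeta {k : ℕ} (σ : ℝ) (φ : Fin k → ℝ → EReal) (θ : Fin k → ℝ) (y : ℝ) : ℝ≥0∞ :=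
  ∫⁻ x, EReal.exp (-(∑ j, (θ j : EReal) * φ j x) - (((y - x) ^ 2 / (2 * σ ^ 2) : ℝ) : EReal))
    / ENNReal.ofReal (Real.sqrt (2 * Real.pi * σ ^ 2))

/-- Extended expectation `E f⁺ - E f⁻`, with the convention that it is `+∞` if `E f⁺ = ∞`. -/
def expect (μ : Measure ℝ) (f : ℝ → EReal) : EReal :=
  -(((∫⁻ y, (-f y).toENNReal ∂μ : ℝ≥0∞) : EReal) - ((∫⁻ y, (f y).toENNReal ∂μ : ℝ≥0∞) : EReal))

/-- `R_+^k`: vectors with strictly positive components. -/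
def posVec (k : ℕ) : Set (Fin k → ℝ) := {θ | ∀ j, 0 < θ j}

/-- The positive parts of `f` are asymptotically uniformly integrable along the laws `Q n`. -/
def AsympUnifIntegrable (Q : ℕ → Measure ℝ) (f : ℝ → EReal) : Prop :=
  ∀ ε : ℝ≥0∞, 0 < ε → ∃ K : ℝ, ∀ᶠ n in atTop, ∫⁻ y, (f y - (K : EReal)).toENNReal ∂(Q n) ≤ ε

/-- The integrability condition is automatic for functions that are bounded above. -/
theorem asympUnifIntegrable_of_le (Q : ℕ → Measure ℝ) (f : ℝ → EReal) (K : ℝ)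
    (hK : ∀ y, f y ≤ (K : EReal)) : AsympUnifIntegrable Q f := by
  refine fun ε _ => ⟨K, Eventually.of_forall fun n => ?_⟩
  have h : ∀ y, (f y - (K : EReal)).toENNReal = 0 := fun y =>
    EReal.toENNReal_of_nonpos (EReal.sub_nonpos.2 (hK y))
  simp [h]

/-- The set of `θ` in `R_+^k` for which the positive part of `log ζ_θ` is asymptotically
uniformly integrable along the single-letter outputs. It contains every `θ` for which
`ζ_θ` is bounded. -/
def admissible {k : ℕ} (σ : ℝ) (φ : Fin k → ℝ → EReal) (Γ : Fin k → ℝ) : Set (Fin k → ℝ) :=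
  {θ | θ ∈ posVec k ∧
    AsympUnifIntegrable (fun n => outputLaw σ (inputMarginal φ Γ n))
      fun y => ENNReal.log (zeta σ φ θ y)}

end

end GaussCap

namespace GaussCap

/-! Take the input uniform on `S_n` and a multiplier `θ` with positive components. On `S_n` the
constraints give `1 ≤ exp(n θ·Γ - ∑ θ·φ(x_t))`, so the indicator of `S_n` is dominated by a product
of functions of one coordinate. Hence the output density is at most `exp(n θ·Γ) ∏ ζ_θ(y_t) /
Vol(S_n)`. Taking expected logarithms bounds the output entropy from below, and subtracting the
noise entropy `n/2 · log(2πeσ²)` bounds `I(X;Y)`.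

The proof never mentions differential entropy. With `g` the noise density, it feeds the test
function `log Vol(S_n) - n θ·Γ + ∑ (log g(y_t - x_t) - h(y_t))` to the Donsker–Varadhan inequality
(`ofReal_integral_le_klDiv`). For almost every output `y`, its exponential integrates over the input
to at most 1 (`lintegral_cond_inputSet_le`), by Tonelli and `ζ_θ ≤ exp h`. Here `h` is `log ζ_θ`
with its negative part truncated, so that it is real and integrable;
`volumeRate_sub_le_blockCapacity` removes the truncation by monotone convergence. Exchangeability of
the coordinates makes the bound single-letter.

The volume exponent exists because concatenation makes `log Vol(S_n)` superadditive (Fekete's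
argument). For the last claim, Gaussian noise upgrades weak convergence of the input laws to
convergence of output expectations of all bounded measurable functions. Uniform integrability of the
positive parts then gives `limsup E log ζ_θ(Y^(n)) ≤ E log ζ_θ(Y)` (`limsup_expect_le`), the only
direction needed. -/

/-! ### Superadditivity and the volume exponent -/

/-- Concatenation of vectors `(x, y) ↦ (x, y)`, `ℝᵐ × ℝⁿ → ℝᵐ⁺ⁿ`, preserves Lebesgue measure. -/
theorem measurePreserving_append (m n : ℕ) :
    MeasurePreserving (fun p : (Fin m → ℝ) × (Fin n → ℝ) => Fin.append p.1 p.2) := by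
  have h1 := volume_measurePreserving_sumPiEquivProdPi_symm (fun _ : Fin m ⊕ Fin n => ℝ)
  have h2 := volume_measurePreserving_piCongrLeft (fun _ : Fin (m + n) => ℝ) finSumFinEquiv
  suffices e : (fun p : (Fin m → ℝ) × (Fin n → ℝ) => Fin.append p.1 p.2) =
      MeasurableEquiv.piCongrLeft (fun _ : Fin (m + n) => ℝ) finSumFinEquiv ∘
        (MeasurableEquiv.sumPiEquivProdPi fun _ : Fin m ⊕ Fin n => ℝ).symm by
    rw [e]; exact h2.comp h1
  funext p i
  refine Fin.addCases (fun i => ?_) (fun i => ?_) i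
  · have := MeasurableEquiv.piCongrLeft_apply_apply (β := fun _ => ℝ) (e := finSumFinEquiv)
      (x := (MeasurableEquiv.sumPiEquivProdPi (fun _ : Fin m ⊕ Fin n => ℝ)).symm p) (i := Sum.inl i)
    simp only [finSumFinEquiv_apply_left] at this
    simp only [Fin.append_left, Function.comp_apply]
    rw [this]; rfl
  · have := MeasurableEquiv.piCongrLeft_apply_apply (β := fun _ => ℝ) (e := finSumFinEquiv)
      (x := (MeasurableEquiv.sumPiEquivProdPi (fun _ : Fin m ⊕ Fin n => ℝ)).symm p) (i := Sum.inr i)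
    simp only [finSumFinEquiv_apply_right] at this
    simp only [Fin.append_right, Function.comp_apply]
    rw [this]; rfl

theorem measurableSet_inputSet {k : ℕ} {φ : Fin k → ℝ → EReal} (hφ : ∀ j, Measurable (φ j))
    (Γ : Fin k → ℝ) (n : ℕ) : MeasurableSet (inputSet φ Γ n) := by
  have : inputSet φ Γ n = ⋂ j, {x : Fin n → ℝ | ∑ t, φ j (x t) ≤ (((n : ℝ) * Γ j : ℝ) : EReal)} := by
    ext x; simp [inputSet]
  rw [this]
  refine MeasurableSet.iInter fun j => measurableSet_le ?_ measurable_const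
  exact Finset.measurable_fun_sum _ fun t _ => (hφ j).comp (measurable_pi_apply t)

/-- Cost budgets add under concatenation, so appending maps `S_m × S_n` into `S_(m+n)`, and it
preserves volume. -/
theorem volume_inputSet_mul_le {k : ℕ} {φ : Fin k → ℝ → EReal} (hφ : ∀ j, Measurable (φ j))
    (Γ : Fin k → ℝ) (m n : ℕ) :
    volume (inputSet φ Γ m) * volume (inputSet φ Γ n) ≤ volume (inputSet φ Γ (m + n)) := by
  rw [← (measurePreserving_append m n).measure_preimage
    (measurableSet_inputSet hφ Γ (m + n)).nullMeasurableSet, Measure.volume_eq_prod,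
    ← Measure.prod_prod]
  refine measure_mono ?_
  rintro ⟨x, y⟩ ⟨hx, hy⟩ j
  have : (((m + n : ℕ) : ℝ) * Γ j : ℝ) = (m : ℝ) * Γ j + (n : ℝ) * Γ j := by push_cast; ring
  rw [this, EReal.coe_add, Fin.sum_univ_add]
  simpa using add_le_add (hx j) (hy j)

/-- A sequence that is superadditive from an index `N` on lies asymptotically above each of
its slopes. -/
theorem slope_le_liminf_of_superadditive {a : ℕ → ℝ} {N : ℕ} (hN : 0 < N)
    (h : ∀ m ≥ N, ∀ n ≥ N, a m + a n ≤ a (m + n)) {m : ℕ} (hm : N ≤ m) :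
    ((a m / m : ℝ) : EReal) ≤ liminf (fun n => ((a n / n : ℝ) : EReal)) atTop := by
  have hm0 : (0 : ℝ) < m := by exact_mod_cast hN.trans_le hm
  have hmul : ∀ r ≥ N, ∀ q : ℕ, q * a m + a r ≤ a (q * m + r) := by
    intro r hr q
    induction q with
    | zero => simp
    | succ q ih =>
      have := h m hm (q * m + r) (by omega)
      have e : m + (q * m + r) = (q + 1) * m + r := by ring
      rw [e] at this
      push_cast
      linarith
  -- Only finitely many remainders `r` occur, so their total defect against the slope `a m / m` is
  -- bounded and vanishes after division by `n`.
  obtain ⟨B, hB⟩ : ∃ B : ℝ, ∀ r ∈ Finset.Ico N (N + m), r * (a m / m) - a r ≤ B := by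
    obtain ⟨B, hB⟩ := ((Finset.Ico N (N + m)).image
      fun r : ℕ => (r : ℝ) * (a m / m) - a r).bddAbove
    exact ⟨B, fun r hr => hB (Finset.mem_coe.2 (Finset.mem_image_of_mem _ hr))⟩
  have key : ∀ n ≥ N, 0 < n → a m / m - B / n ≤ a n / n := by
    intro n hn hn0
    have hn0' : (0 : ℝ) < n := by exact_mod_cast hn0
    -- The remainder is shifted up by `N`, since superadditivity is available only for indices at
    -- least `N`.
    set q := (n - N) / m
    set r := N + (n - N) % m
    have hr : r ∈ Finset.Ico N (N + m) := by
      simp only [Finset.mem_Ico, r]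
      exact ⟨by omega, by have := Nat.mod_lt (n - N) (hN.trans_le hm); omega⟩
    have hqr : q * m + r = n := by
      have := Nat.div_add_mod' (n - N) m
      simp only [q, r]; omega
    have h1 := hmul r (Finset.mem_Ico.1 hr).1 q
    rw [hqr] at h1
    have h2 := hB r hr
    have h3 : (n : ℝ) * (a m / m) = q * a m + r * (a m / m) := by
      rw [← hqr]; push_cast; field_simp
    rw [← sub_nonneg]
    have : a n / n - (a m / m - B / n) = (a n - n * (a m / m) + B) / n := by
      field_simp; ring
    rw [this]
    apply div_nonneg _ hn0'.le
    linarith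
  have hlim : Tendsto (fun n : ℕ => ((a m / m - B / n : ℝ) : EReal)) atTop
      (𝓝 ((a m / m : ℝ) : EReal)) := by
    rw [EReal.tendsto_coe]
    simpa using (tendsto_const_nhds (x := a m / m)).sub (tendsto_const_div_atTop_nhds_zero_nat B)
  rw [← hlim.liminf_eq]
  refine liminf_le_liminf ?_
  filter_upwards [eventually_ge_atTop N] with n hn
  exact_mod_cast key n hn (hN.trans_le hn)

theorem volumeRate_eq_coe {k : ℕ} {φ : Fin k → ℝ → EReal} {Γ : Fin k → ℝ} {n : ℕ}
    (h : 0 < volume (inputSet φ Γ n)) (h' : volume (inputSet φ Γ n) < ∞) :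
    volumeRate φ Γ n = ((Real.log (volume (inputSet φ Γ n)).toReal / n : ℝ) : EReal) := by
  rw [volumeRate, EReal.coe_div, ENNReal.log_pos_real h.ne' h'.ne]

/-- The volume exponent is a limit, and it is not `-∞`. -/
theorem tendsto_volumeRate {k : ℕ} {φ : Fin k → ℝ → EReal} (hφ : ∀ j, Measurable (φ j))
    {Γ : Fin k → ℝ}
    (hvol : ∀ᶠ n in atTop, 0 < volume (inputSet φ Γ n) ∧ volume (inputSet φ Γ n) < ∞) :
    Tendsto (fun n => volumeRate φ Γ n) atTop (𝓝 (volumeExponent φ Γ)) ∧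
      ⊥ < volumeExponent φ Γ := by
  obtain ⟨N', hN'⟩ := eventually_atTop.1 hvol
  set N := N' + 1
  have hN : ∀ n ≥ N, 0 < volume (inputSet φ Γ n) ∧ volume (inputSet φ Γ n) < ∞ :=
    fun n hn => hN' n (by omega)
  set a : ℕ → ℝ := fun n => Real.log (volume (inputSet φ Γ n)).toReal
  have ha : ∀ m ≥ N, ∀ n ≥ N, a m + a n ≤ a (m + n) := by
    intro m hm n hn
    have pm := ENNReal.toReal_pos (hN m hm).1.ne' (hN m hm).2.ne
    have pn := ENNReal.toReal_pos (hN n hn).1.ne' (hN n hn).2.ne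
    simp only [a]
    rw [← Real.log_mul pm.ne' pn.ne', ← ENNReal.toReal_mul]
    refine Real.log_le_log ?_ (ENNReal.toReal_mono (hN (m + n) (by omega)).2.ne
      (volume_inputSet_mul_le hφ Γ m n))
    rw [ENNReal.toReal_mul]; positivity
  have hrate : (fun n => volumeRate φ Γ n) =ᶠ[atTop] fun n => ((a n / n : ℝ) : EReal) := by
    filter_upwards [eventually_ge_atTop N] with n hn
    exact volumeRate_eq_coe (hN n hn).1 (hN n hn).2
  have hv : volumeExponent φ Γ = liminf (fun n => ((a n / n : ℝ) : EReal)) atTop :=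
    liminf_congr hrate
  have hle : ∀ m ≥ N, ((a m / m : ℝ) : EReal) ≤ volumeExponent φ Γ := fun m hm => by
    rw [hv]; exact slope_le_liminf_of_superadditive (Nat.succ_pos _) ha hm
  refine ⟨?_, (EReal.bot_lt_coe _).trans_le (hle N le_rfl)⟩
  refine tendsto_of_le_liminf_of_limsup_le le_rfl ?_
  rw [limsup_congr hrate]
  refine limsup_le_of_le (by isBoundedDefault) ?_
  filter_upwards [eventually_ge_atTop N] with n hn using hle n hn

/-! ### Variational bound for the divergence, and Tonelli for products -/

/-- The Donsker–Varadhan lower bound for the Kullback–Leibler divergence. -/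
theorem ofReal_integral_le_klDiv {α : Type*} [MeasurableSpace α] {μ ν : Measure α}
    [IsProbabilityMeasure μ] [IsProbabilityMeasure ν] {f : α → ℝ} (hf : Integrable f μ)
    (hfm : Measurable f) (hν : ∫⁻ x, ENNReal.ofReal (Real.exp (f x)) ∂ν ≤ 1) :
    ENNReal.ofReal (∫ x, f x ∂μ) ≤ InformationTheory.klDiv μ ν := by
  by_cases htop : InformationTheory.klDiv μ ν = ∞
  · simp [htop]
  obtain ⟨hac, hllr⟩ := InformationTheory.klDiv_ne_top_iff.1 htop
  have hint : Integrable (fun x => Real.exp (f x)) ν := by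
    refine ⟨(Real.measurable_exp.comp hfm).aestronglyMeasurable, ?_⟩
    rw [hasFiniteIntegral_iff_ofReal (ae_of_all _ fun x => (Real.exp_pos _).le)]
    exact hν.trans_lt ENNReal.one_lt_top
  have h1 : ∫ x, Real.exp (f x) ∂ν ≤ 1 := by
    rw [integral_eq_lintegral_of_nonneg_ae (ae_of_all _ fun x => (Real.exp_pos _).le)
      hint.aestronglyMeasurable]
    exact ENNReal.toReal_le_of_le_ofReal zero_le_one (by simpa using hν)
  have hpos : 0 < ∫ x, Real.exp (f x) ∂ν := integral_exp_pos hint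
  -- The divergence from the tilted measure is nonnegative and equals `klDiv μ ν - ∫ f ∂μ + log ∫
  -- exp f ∂ν`, whose last term is at most 0.
  have hac' : μ ≪ ν.tilted f := hac.trans (absolutelyContinuous_tilted hint)
  have := isProbabilityMeasure_tilted hint
  have h2 := InformationTheory.toReal_klDiv_of_measure_eq hac' (by simp)
  have h3 := InformationTheory.toReal_klDiv_of_measure_eq hac (by simp)
  rw [integral_llr_tilted_right hac hf hint hllr] at h2
  have h4 := Real.log_nonpos hpos.le h1
  have h5 : 0 ≤ (InformationTheory.klDiv μ (ν.tilted f)).toReal := ENNReal.toReal_nonneg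
  rw [← ENNReal.ofReal_toReal htop]
  exact ENNReal.ofReal_le_ofReal (by linarith)

/-- Tonelli's theorem for products of functions of one coordinate. -/
theorem lintegral_fin_prod_eq_prod {n : ℕ} {f : Fin n → ℝ → ℝ≥0∞} (hf : ∀ i, Measurable (f i)) :
    ∫⁻ x : Fin n → ℝ, ∏ i, f i (x i) = ∏ i, ∫⁻ x, f i x := by
  induction n with
  | zero => simp [volume_pi]
  | succ n ih =>
    have e := (volume_preserving_piFinSuccAbove (fun _ : Fin (n + 1) => ℝ) 0).symm
    rw [← e.lintegral_comp_emb (MeasurableEquiv.measurableEmbedding _)]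
    have hp : ∀ p : ℝ × (Fin n → ℝ),
        ∏ i, f i ((MeasurableEquiv.piFinSuccAbove (fun _ : Fin (n + 1) => ℝ) 0).symm p i) =
          f 0 p.1 * ∏ i : Fin n, f i.succ (p.2 i) := fun p => by
      rw [Fin.prod_univ_succ]; rfl
    rw [lintegral_congr hp, Fin.prod_univ_succ, ← ih fun i => hf i.succ]
    refine lintegral_prod_mul (μ := volume) (ν := volume) (f := f 0)
      (g := fun x : Fin n → ℝ => ∏ i, f i.succ (x i)) (hf 0).aemeasurable ?_
    exact (Finset.measurable_fun_prod _ fun i _ =>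
      (hf i.succ).comp (measurable_pi_apply i)).aemeasurable

/-! ### The cost weights and `ζ_θ` -/

noncomputable section

/-- The unnormalised density `exp(-θ·φ(x))`. -/
def costWeight {k : ℕ} (φ : Fin k → ℝ → EReal) (θ : Fin k → ℝ) (x : ℝ) : ℝ≥0∞ :=
  EReal.exp (-(∑ j, (θ j : EReal) * φ j x))

end

variable {k : ℕ} {φ : Fin k → ℝ → EReal} {Γ θ : Fin k → ℝ} {σ : ℝ}

theorem measurable_costWeight (hφ : ∀ j, Measurable (φ j)) (θ : Fin k → ℝ) :
    Measurable (costWeight φ θ) := by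
  refine Measurable.ereal_exp (Measurable.neg ?_)
  exact Finset.measurable_fun_sum _ fun j _ => measurable_const.mul (hφ j)

theorem measurable_gaussianPDF_swap (v : ℝ≥0) :
    Measurable fun p : ℝ × ℝ => gaussianPDF p.2 v p.1 := by
  unfold gaussianPDF gaussianPDFReal
  fun_prop

theorem measurable_gaussianPDF_mean (v : ℝ≥0) (y : ℝ) :
    Measurable fun x : ℝ => gaussianPDF x v y := by
  unfold gaussianPDF gaussianPDFReal
  fun_prop

/-- This form separates the weight from the Gaussian kernel, so that `ζ_θ` appears as the coordinate
integral in Tonelli's theorem. -/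
theorem zeta_eq_lintegral_costWeight (hσ : 0 < σ) (y : ℝ) :
    zeta σ φ θ y = ∫⁻ x, costWeight φ θ x * gaussianPDF x (σ ^ 2).toNNReal y := by
  refine lintegral_congr fun x => ?_
  have hs : 0 < Real.sqrt (2 * Real.pi * σ ^ 2) := Real.sqrt_pos.2 (by positivity)
  rw [sub_eq_add_neg, EReal.exp_add, costWeight, ← EReal.coe_neg, EReal.exp_coe, gaussianPDF,
    gaussianPDFReal, Real.coe_toNNReal _ (sq_nonneg σ), ENNReal.div_eq_inv_mul,
    ENNReal.ofReal_mul (inv_nonneg.2 hs.le), ENNReal.ofReal_inv_of_pos hs, neg_div]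
  ring

theorem measurable_zeta (hσ : 0 < σ) (hφ : ∀ j, Measurable (φ j)) :
    Measurable (zeta σ φ θ) := by
  have : zeta σ φ θ = fun y => ∫⁻ x, costWeight φ θ x * gaussianPDF x (σ ^ 2).toNNReal y :=
    funext fun y => zeta_eq_lintegral_costWeight hσ y
  rw [this]
  refine Measurable.lintegral_prod_right'
    (f := fun p : ℝ × ℝ => costWeight φ θ p.2 * gaussianPDF p.2 (σ ^ 2).toNNReal p.1) ?_
  have h := measurable_gaussianPDF_swap (σ ^ 2).toNNReal
  exact ((measurable_costWeight hφ θ).comp measurable_snd).mul h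

theorem sum_ne_bot {ι : Type*} {s : Finset ι} {f : ι → EReal} (h : ∀ i ∈ s, f i ≠ ⊥) :
    ∑ i ∈ s, f i ≠ ⊥ := by
  classical
  induction s using Finset.induction_on with
  | empty => simp
  | insert a s ha ih =>
    rw [Finset.sum_insert ha, Ne, EReal.add_eq_bot_iff, not_or]
    exact ⟨h a (by simp), ih fun i hi => h i (by simp [hi])⟩

/-- With no `⊥` among the terms, one `⊤` makes the sum `⊤`; a `⊥` would hide it, because `⊤ + ⊥ = ⊥`
in `EReal`. This makes all costs along an admissible vector real. -/
theorem ne_top_of_sum_ne_top {ι : Type*} {s : Finset ι} {f : ι → EReal} (h : ∀ i ∈ s, f i ≠ ⊥)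
    (hs : ∑ i ∈ s, f i ≠ ⊤) {i : ι} (hi : i ∈ s) : f i ≠ ⊤ := by
  classical
  intro ht
  rw [← Finset.add_sum_erase s f hi, ht] at hs
  exact hs (EReal.top_add_of_ne_bot (sum_ne_bot fun j hj => h j (Finset.mem_of_mem_erase hj)))

theorem coe_sum_ereal {ι : Type*} (s : Finset ι) (f : ι → ℝ) :
    ((∑ i ∈ s, f i : ℝ) : EReal) = ∑ i ∈ s, (f i : EReal) := by
  classical
  induction s using Finset.induction_on with
  | empty => simp
  | insert a s ha ih => rw [Finset.sum_insert ha, Finset.sum_insert ha, EReal.coe_add, ih]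

/-- On the input set the product of the weights is at least `exp(-n θ·Γ)`. -/
theorem exp_le_prod_costWeight (hφ_bot : ∀ j x, φ j x ≠ ⊥) (hθ : θ ∈ posVec k) {n : ℕ}
    {x : Fin n → ℝ} (hx : x ∈ inputSet φ Γ n) :
    ENNReal.ofReal (Real.exp (-(n * ∑ j, θ j * Γ j))) ≤ ∏ t, costWeight φ θ (x t) := by
  have hfin : ∀ j t, φ j (x t) = ((φ j (x t)).toReal : EReal) := fun j t =>
    (EReal.coe_toReal (ne_top_of_sum_ne_top (fun i _ => hφ_bot j (x i))
      ((hx j).trans_lt (EReal.coe_lt_top _)).ne (Finset.mem_univ t)) (hφ_bot j _)).symm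
  have hw : ∀ t, costWeight φ θ (x t) =
      ENNReal.ofReal (Real.exp (-∑ j, θ j * (φ j (x t)).toReal)) := fun t => by
    rw [costWeight, ← EReal.exp_coe, EReal.coe_neg, coe_sum_ereal]
    congr 2
    exact Finset.sum_congr rfl fun j _ => by rw [EReal.coe_mul, ← hfin]
  have hsum : ∀ j, ∑ t, (φ j (x t)).toReal ≤ n * Γ j := fun j => by
    have := hx j
    rw [Finset.sum_congr rfl fun t _ => hfin j t, ← coe_sum_ereal] at this
    exact_mod_cast this
  simp_rw [hw]
  rw [← ENNReal.ofReal_prod_of_nonneg fun _ _ => (Real.exp_pos _).le, ← Real.exp_sum]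
  refine ENNReal.ofReal_le_ofReal (Real.exp_le_exp.2 ?_)
  rw [Finset.sum_neg_distrib, neg_le_neg_iff, Finset.sum_comm, Finset.mul_sum]
  refine Finset.sum_le_sum fun j _ => ?_
  rw [← Finset.mul_sum]
  nlinarith [mul_le_mul_of_nonneg_left (hsum j) (hθ j).le]

/-! ### Single-letter marginals of the channel law -/

/-- All components of the uniform input have the same law. -/
theorem map_eval_cond_inputSet (hφ : ∀ j, Measurable (φ j)) (Γ : Fin k → ℝ) (n : ℕ)
    (t : Fin (n + 1)) :
    (ProbabilityTheory.cond volume (inputSet φ Γ (n + 1))).map (fun x => x t) =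
      inputMarginal φ Γ n := by
  have hS := measurableSet_inputSet hφ Γ (n + 1)
  -- Swapping coordinates `0` and `t` preserves both volume and the constraints, which are symmetric
  -- in the coordinates.
  have hT := volume_measurePreserving_piCongrLeft (fun _ : Fin (n + 1) => ℝ) (Equiv.swap 0 t)
  have hTx : ∀ x i, MeasurableEquiv.piCongrLeft (fun _ : Fin (n + 1) => ℝ) (Equiv.swap 0 t) x
      (Equiv.swap 0 t i) = x i := fun x i =>
    MeasurableEquiv.piCongrLeft_apply_apply (β := fun _ => ℝ) (e := Equiv.swap 0 t) (x := x) i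
  ext A hA
  rw [inputMarginal, Measure.map_apply (measurable_pi_apply t) hA,
    Measure.map_apply (measurable_pi_apply 0) hA, cond_apply hS, cond_apply hS]
  congr 1
  rw [← hT.measure_preimage (hS.inter (measurable_pi_apply 0 hA)).nullMeasurableSet]
  congr 1
  ext x
  have h0 := hTx x t
  rw [Equiv.swap_apply_right] at h0
  simp only [Set.mem_inter_iff, Set.mem_preimage, h0]
  refine and_congr_left fun _ => forall_congr' fun j => ?_
  rw [← Equiv.sum_comp (Equiv.swap 0 t) fun i => φ j (MeasurableEquiv.piCongrLeft
    (fun _ : Fin (n + 1) => ℝ) (Equiv.swap 0 t) x i)]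
  simp_rw [hTx]

theorem measurePreserving_channelJoint_noise (σ : ℝ) (n : ℕ) (q : Measure (Fin n → ℝ))
    [IsProbabilityMeasure q] (t : Fin n) :
    MeasurePreserving (fun p : (Fin n → ℝ) × (Fin n → ℝ) => p.2 t - p.1 t) (channelJoint σ n q)
      (gaussianReal 0 (Real.toNNReal (σ ^ 2))) := by
  refine ⟨by fun_prop, ?_⟩
  have h1 := measurePreserving_eval
    (fun _ : Fin n => gaussianReal 0 (Real.toNNReal (σ ^ 2))) t
  have h2 : MeasurePreserving Prod.snd (q.prod (noise σ n)) (noise σ n) := by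
    have : IsProbabilityMeasure (noise σ n) := by unfold noise; infer_instance
    exact measurePreserving_snd
  rw [channelJoint, Measure.map_map (by fun_prop) (by fun_prop), ← (h1.comp h2).map_eq]
  congr 1
  funext p
  simp

theorem measurePreserving_channelJoint_output (hφ : ∀ j, Measurable (φ j)) (σ : ℝ)
    (Γ : Fin k → ℝ) (n : ℕ) (t : Fin (n + 1)) :
    MeasurePreserving (fun p : (Fin (n + 1) → ℝ) × (Fin (n + 1) → ℝ) => p.2 t)
      (channelJoint σ (n + 1) (ProbabilityTheory.cond volume (inputSet φ Γ (n + 1))))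
      (outputLaw σ (inputMarginal φ Γ n)) := by
  refine ⟨by fun_prop, ?_⟩
  have h1 := measurePreserving_eval
    (fun _ : Fin (n + 1) => gaussianReal 0 (Real.toNNReal (σ ^ 2))) t
  have : IsProbabilityMeasure (noise σ (n + 1)) := by unfold noise; infer_instance
  rw [outputLaw, ← map_eval_cond_inputSet hφ Γ n t, ← h1.map_eq,
    Measure.map_prod_map _ _ (measurable_pi_apply t) (measurable_pi_apply t),
    Measure.map_map (by fun_prop) (by fun_prop), channelJoint,
    Measure.map_map (by fun_prop) (by fun_prop)]
  rfl

theorem log_gaussianPDFReal {v : ℝ≥0} (hv : v ≠ 0) (x y : ℝ) :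
    Real.log (gaussianPDFReal x v y) =
      -(1 / 2 * Real.log (2 * Real.pi * v)) - (y - x) ^ 2 / (2 * v) := by
  have hv' : (0 : ℝ) < v := by positivity
  have h : 0 < 2 * Real.pi * (v : ℝ) := by positivity
  rw [gaussianPDFReal, Real.log_mul (by positivity) (Real.exp_pos _).ne', Real.log_exp,
    Real.log_inv, Real.log_sqrt h.le]
  ring

theorem integrable_sq_gaussianReal (v : ℝ≥0) :
    Integrable (fun z : ℝ => z ^ 2) (gaussianReal 0 v) := by
  simpa using (memLp_id_gaussianReal (μ := 0) (v := v) 2).integrable_sq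

theorem integral_sq_gaussianReal (v : ℝ≥0) : ∫ z, z ^ 2 ∂gaussianReal 0 v = v := by
  have h := variance_id_gaussianReal (μ := 0) (v := v)
  rw [variance_of_integral_eq_zero aemeasurable_id (by simp)] at h
  simpa using h

instance isProbabilityMeasure_noise (σ : ℝ) (n : ℕ) : IsProbabilityMeasure (noise σ n) := by
  unfold noise; infer_instance

instance isProbabilityMeasure_channelJoint (σ : ℝ) (n : ℕ) (q : Measure (Fin n → ℝ))
    [IsProbabilityMeasure q] : IsProbabilityMeasure (channelJoint σ n q) :=
  Measure.isProbabilityMeasure_map (by fun_prop)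

theorem fst_channelJoint (σ : ℝ) (n : ℕ) (q : Measure (Fin n → ℝ)) [IsProbabilityMeasure q] :
    (channelJoint σ n q).fst = q := by
  rw [Measure.fst, channelJoint, Measure.map_map (by fun_prop) (by fun_prop)]
  exact measurePreserving_fst.map_eq

/-! ### The Gibbs bound for the uniform input -/

/-- The integrand of the Gibbs bound integrates to at most one over the input set. -/
theorem lintegral_cond_inputSet_le (hσ : 0 < σ) (hφ : ∀ j, Measurable (φ j))
    (hφ_bot : ∀ j x, φ j x ≠ ⊥) (hθ : θ ∈ posVec k) {n : ℕ}
    (h0 : 0 < volume (inputSet φ Γ n)) (h1 : volume (inputSet φ Γ n) < ∞)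
    {h : ℝ → ℝ} {y : Fin n → ℝ}
    (hy : ∀ t, zeta σ φ θ (y t) ≤ ENNReal.ofReal (Real.exp (h (y t)))) :
    ∫⁻ x, ENNReal.ofReal (Real.exp (Real.log (volume (inputSet φ Γ n)).toReal
        - n * ∑ j, θ j * Γ j
        + ∑ t, (Real.log (gaussianPDFReal (x t) (σ ^ 2).toNNReal (y t)) - h (y t))))
      ∂(ProbabilityTheory.cond volume (inputSet φ Γ n)) ≤ 1 := by
  set S := inputSet φ Γ n
  obtain ⟨v, hvdef⟩ : ∃ v, v = (σ ^ 2).toNNReal := ⟨_, rfl⟩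
  have hv : v ≠ 0 := by simpa [hvdef] using hσ.ne'
  rw [← hvdef]
  have hVpos := ENNReal.toReal_pos h0.ne' h1.ne
  have hS : MeasurableSet S := measurableSet_inputSet hφ Γ n
  -- Each factor integrates over `ℝ` to `ζ_θ(y_t) exp(-h(y_t)) ≤ 1`.
  set w : Fin n → ℝ → ℝ≥0∞ := fun t x =>
    costWeight φ θ x * gaussianPDF x v (y t) * ENNReal.ofReal (Real.exp (-h (y t)))
  have hwm' : ∀ t, Measurable fun x => costWeight φ θ x * gaussianPDF x v (y t) := fun t =>
    (measurable_costWeight hφ θ).mul (measurable_gaussianPDF_mean v (y t))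
  have hwm : ∀ t, Measurable (w t) := fun t => (hwm' t).mul_const _
  have hle : ∀ x ∈ S, ENNReal.ofReal (Real.exp (Real.log (volume S).toReal
      - n * ∑ j, θ j * Γ j
      + ∑ t, (Real.log (gaussianPDFReal (x t) v (y t)) - h (y t)))) ≤
      volume S * ∏ t, w t (x t) := by
    intro x hx
    have hprod : ENNReal.ofReal (Real.exp (∑ t, (Real.log (gaussianPDFReal (x t) v (y t))
        - h (y t)))) =
        ∏ t, (gaussianPDF (x t) v (y t) * ENNReal.ofReal (Real.exp (-h (y t)))) := by
      rw [Real.exp_sum, ENNReal.ofReal_prod_of_nonneg fun _ _ => (Real.exp_pos _).le]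
      refine Finset.prod_congr rfl fun t _ => ?_
      rw [sub_eq_add_neg, Real.exp_add, Real.exp_log (gaussianPDFReal_pos _ _ _ hv),
        ENNReal.ofReal_mul (gaussianPDFReal_nonneg _ _ _), gaussianPDF]
    rw [Real.exp_add, sub_eq_add_neg, Real.exp_add, Real.exp_log hVpos,
      ENNReal.ofReal_mul (by positivity), ENNReal.ofReal_mul hVpos.le, ENNReal.ofReal_toReal h1.ne,
      hprod, mul_assoc]
    refine mul_le_mul_right ?_ _
    simp only [w, mul_assoc]
    rw [Finset.prod_mul_distrib (f := fun t => costWeight φ θ (x t))]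
    exact mul_le_mul_left (exp_le_prod_costWeight hφ_bot hθ hx) _
  refine (lintegral_mono_ae ((ae_cond_mem hS).mono hle)).trans ?_
  rw [ProbabilityTheory.cond, lintegral_smul_measure, smul_eq_mul, lintegral_const_mul' _ _ h1.ne,
    ← mul_assoc, ENNReal.inv_mul_cancel h0.ne' h1.ne, one_mul]
  -- The volume has cancelled against the uniform density. Enlarging the domain from `S` to the
  -- whole space lets the integral factor over the coordinates.
  refine (setLIntegral_le_lintegral _ _).trans ?_
  rw [lintegral_fin_prod_eq_prod hwm]
  refine Finset.prod_le_one' fun t _ => ?_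
  simp only [w]
  rw [lintegral_mul_const _ (hwm' t), hvdef, ← zeta_eq_lintegral_costWeight hσ, Real.exp_neg,
    ENNReal.ofReal_inv_of_pos (Real.exp_pos _)]
  exact (mul_le_mul_left (hy t) _).trans (ENNReal.mul_inv_le_one _)

/-- Gibbs bound for the mutual information achieved by the uniform input. -/
theorem ofReal_le_mutualInfo (hσ : 0 < σ) (hφ : ∀ j, Measurable (φ j))
    (hφ_bot : ∀ j x, φ j x ≠ ⊥) (hθ : θ ∈ posVec k) {n : ℕ}
    (h0 : 0 < volume (inputSet φ Γ (n + 1))) (h1 : volume (inputSet φ Γ (n + 1)) < ∞)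
    {h : ℝ → ℝ} (hm : Measurable h) (hint : Integrable h (outputLaw σ (inputMarginal φ Γ n)))
    (hζ : ∀ᵐ y ∂outputLaw σ (inputMarginal φ Γ n),
      zeta σ φ θ y ≤ ENNReal.ofReal (Real.exp (h y))) :
    ENNReal.ofReal (Real.log (volume (inputSet φ Γ (n + 1))).toReal
        - (n + 1 : ℕ) * ∑ j, θ j * Γ j
        + (n + 1 : ℕ) * (-(1 / 2 * Real.log (2 * Real.pi * Real.exp 1 * σ ^ 2))
          - ∫ y, h y ∂outputLaw σ (inputMarginal φ Γ n))) ≤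
      mutualInfo (channelJoint σ (n + 1)
        (ProbabilityTheory.cond volume (inputSet φ Γ (n + 1)))) := by
  have hq := cond_isProbabilityMeasure_of_finite h0.ne' h1.ne
  set q := ProbabilityTheory.cond volume (inputSet φ Γ (n + 1)) with hqdef
  set ρ := channelJoint σ (n + 1) q with hρdef
  set v := (σ ^ 2).toNNReal with hvdef
  have hvσ : (v : ℝ) = σ ^ 2 := Real.coe_toNNReal _ (sq_nonneg σ)
  have hv : v ≠ 0 := by simpa [v] using hσ.ne'
  have hY := measurePreserving_channelJoint_output hφ σ Γ n
  have hZ := measurePreserving_channelJoint_noise σ (n + 1) q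
  rw [← hqdef, ← hρdef] at hY
  rw [← hρdef, ← hvdef] at hZ
  -- The log-density of the noise; its mean is minus the noise entropy.
  set G : ℝ → ℝ := fun z => -(1 / 2 * Real.log (2 * Real.pi * v)) - z ^ 2 / (2 * v)
  have hGm : Measurable G := by fun_prop
  have hGi : Integrable G (gaussianReal 0 v) :=
    (integrable_const _).sub ((integrable_sq_gaussianReal v).div_const _)
  have hG : ∫ z, G z ∂gaussianReal 0 v =
      -(1 / 2 * Real.log (2 * Real.pi * Real.exp 1 * σ ^ 2)) := by
    rw [integral_sub (integrable_const _) ((integrable_sq_gaussianReal v).div_const _),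
      integral_div, integral_sq_gaussianReal, integral_const, probReal_univ, one_smul, hvσ]
    have e : 2 * Real.pi * Real.exp 1 * σ ^ 2 = 2 * Real.pi * σ ^ 2 * Real.exp 1 := by ring
    rw [e, Real.log_mul (by positivity) (Real.exp_pos _).ne', Real.log_exp]
    field_simp
    ring
  have hterm : ∀ t : Fin (n + 1), Integrable (fun p : (Fin (n + 1) → ℝ) × (Fin (n + 1) → ℝ) =>
      G (p.2 t - p.1 t) - h (p.2 t)) ρ := fun t =>
    ((hZ t).integrable_comp_of_integrable hGi).sub ((hY t).integrable_comp_of_integrable hint)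
  have hval : ∀ t : Fin (n + 1), ∫ p, (G (p.2 t - p.1 t) - h (p.2 t)) ∂ρ =
      -(1 / 2 * Real.log (2 * Real.pi * Real.exp 1 * σ ^ 2))
        - ∫ y, h y ∂outputLaw σ (inputMarginal φ Γ n) := fun t => by
    have e := integral_sub ((hZ t).integrable_comp_of_integrable hGi)
      ((hY t).integrable_comp_of_integrable hint)
    simp only [Function.comp_apply] at e
    rw [e, ← hG, ← (hZ t).map_eq, ← (hY t).map_eq,
      integral_map (hZ t).aemeasurable hGm.aestronglyMeasurable,
      integral_map (hY t).aemeasurable hm.aestronglyMeasurable]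
  set c := Real.log (volume (inputSet φ Γ (n + 1))).toReal - (n + 1 : ℕ) * ∑ j, θ j * Γ j
  set f : (Fin (n + 1) → ℝ) × (Fin (n + 1) → ℝ) → ℝ := fun p =>
    c + ∑ t, (G (p.2 t - p.1 t) - h (p.2 t))
  have hfm : Measurable f := by fun_prop
  have hfi : Integrable f ρ := (integrable_const _).add (integrable_finsetSum _ fun t _ => hterm t)
  have hfint : ∫ p, f p ∂ρ = c + (n + 1 : ℕ) *
      (-(1 / 2 * Real.log (2 * Real.pi * Real.exp 1 * σ ^ 2))
        - ∫ y, h y ∂outputLaw σ (inputMarginal φ Γ n)) := by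
    rw [integral_add (integrable_const _) (integrable_finsetSum _ fun t _ => hterm t),
      integral_finsetSum _ fun t _ => hterm t, Finset.sum_congr rfl fun t _ => hval t]
    simp [mul_sub]
  rw [← hfint, mutualInfo]
  have : IsProbabilityMeasure ρ.fst := Measure.isProbabilityMeasure_map (by fun_prop)
  have : IsProbabilityMeasure ρ.snd := Measure.isProbabilityMeasure_map (by fun_prop)
  refine ofReal_integral_le_klDiv hfi hfm ?_
  -- The input is integrated first, with the output held fixed: the bound by 1 holds for almost
  -- every `y` separately.
  rw [fst_channelJoint, lintegral_prod_symm' _ (by fun_prop)]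
  have hae : ∀ᵐ y ∂ρ.snd, ∀ t, zeta σ φ θ (y t) ≤ ENNReal.ofReal (Real.exp (h (y t))) := by
    refine ae_all_iff.2 fun t => ?_
    have hYs : MeasurePreserving (fun y : Fin (n + 1) → ℝ => y t) ρ.snd
        (outputLaw σ (inputMarginal φ Γ n)) := by
      refine ⟨by fun_prop, ?_⟩
      rw [Measure.snd, Measure.map_map (by fun_prop) (by fun_prop)]
      exact (hY t).map_eq
    exact hYs.quasiMeasurePreserving.ae hζ
  have hle : ∀ᵐ y ∂ρ.snd, ∫⁻ x, ENNReal.ofReal (Real.exp (f (x, y))) ∂q ≤ 1 := by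
    filter_upwards [hae] with y hy
    have := lintegral_cond_inputSet_le hσ hφ hφ_bot hθ h0 h1 hy
    simpa only [← hvdef, log_gaussianPDFReal hv, f, G, c, q] using this
  calc _ ≤ ∫⁻ _, 1 ∂ρ.snd := lintegral_mono_ae hle
    _ = 1 := by simp

/-! ### Truncation and the bound at a fixed block length -/

/-- Truncating the negative part of `log z` only increases its exponential. -/
theorem le_exp_truncated_log {z : ℝ≥0∞} (hz : z ≠ ∞) {M : ℝ≥0∞} :
    z ≤ ENNReal.ofReal (Real.exp ((ENNReal.log z).toENNReal.toReal
      - (min (-ENNReal.log z).toENNReal M).toReal)) := by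
  rcases eq_or_ne z 0 with rfl | h0
  · simp
  have hpos := ENNReal.toReal_pos h0 hz
  rw [ENNReal.log_pos_real h0 hz, ← EReal.coe_neg, EReal.real_coe_toENNReal,
    EReal.real_coe_toENNReal, ENNReal.toReal_ofReal']
  have h1 : (min (ENNReal.ofReal (-Real.log z.toReal)) M).toReal ≤ max (-Real.log z.toReal) 0 := by
    rw [← ENNReal.toReal_ofReal']
    exact ENNReal.toReal_mono ENNReal.ofReal_ne_top (min_le_left _ _)
  conv_lhs => rw [← ENNReal.ofReal_toReal hz, ← Real.exp_log hpos]
  refine ENNReal.ofReal_le_ofReal (Real.exp_le_exp.2 ?_)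
  rcases le_total 0 (Real.log z.toReal) with h | h
  · rw [max_eq_right (by linarith)] at h1
    rw [max_eq_left h]; linarith
  · rw [max_eq_left (by linarith)] at h1
    rw [max_eq_right h]; linarith

section Truncation

variable {Q : Measure ℝ} {a b : ℝ → ℝ≥0∞}

theorem integrable_toReal_sub_toReal (ha : Measurable a) (hb : Measurable b)
    (ha' : ∫⁻ y, a y ∂Q ≠ ∞) (hb' : ∫⁻ y, b y ∂Q ≠ ∞) :
    Integrable (fun y => (a y).toReal - (b y).toReal) Q :=
  (integrable_toReal_of_lintegral_ne_top ha.aemeasurable ha').sub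
    (integrable_toReal_of_lintegral_ne_top hb.aemeasurable hb')

theorem integral_toReal_sub_toReal (ha : Measurable a) (hb : Measurable b)
    (ha' : ∫⁻ y, a y ∂Q ≠ ∞) (hb' : ∫⁻ y, b y ∂Q ≠ ∞) :
    ∫ y, ((a y).toReal - (b y).toReal) ∂Q = (∫⁻ y, a y ∂Q).toReal - (∫⁻ y, b y ∂Q).toReal := by
  rw [integral_sub (integrable_toReal_of_lintegral_ne_top ha.aemeasurable ha')
    (integrable_toReal_of_lintegral_ne_top hb.aemeasurable hb'),
    integral_toReal ha.aemeasurable (ae_lt_top ha ha'),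
    integral_toReal hb.aemeasurable (ae_lt_top hb hb')]

theorem lintegral_min_ne_top [IsFiniteMeasure Q] (b : ℝ → ℝ≥0∞) {M : ℝ≥0∞} (hM : M ≠ ∞) :
    ∫⁻ y, min (b y) M ∂Q ≠ ∞ := by
  refine ((lintegral_mono fun y => min_le_right (b y) M).trans_lt ?_).ne
  rw [lintegral_const]
  exact ENNReal.mul_lt_top hM.lt_top (measure_lt_top Q _)

theorem tendsto_lintegral_min_natCast (hb : Measurable b) :
    Tendsto (fun M : ℕ => ∫⁻ y, min (b y) M ∂Q) atTop (𝓝 (∫⁻ y, b y ∂Q)) := by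
  refine lintegral_tendsto_of_tendsto_of_monotone
    (fun M => (hb.min measurable_const).aemeasurable)
    (ae_of_all _ fun y M N h => min_le_min le_rfl (by exact_mod_cast h)) (ae_of_all _ fun y => ?_)
  simpa using (tendsto_const_nhds (x := b y)).min ENNReal.tendsto_nat_nhds_top

end Truncation

theorem expect_eq_top {Q : Measure ℝ} {f : ℝ → EReal} (h : ∫⁻ y, (f y).toENNReal ∂Q = ∞) :
    expect Q f = ⊤ := by
  simp [expect, h]

theorem expect_eq_coe {Q : Measure ℝ} {f : ℝ → EReal} (h : ∫⁻ y, (f y).toENNReal ∂Q ≠ ∞)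
    (h' : ∫⁻ y, (-f y).toENNReal ∂Q ≠ ∞) :
    expect Q f = (((∫⁻ y, (f y).toENNReal ∂Q).toReal - (∫⁻ y, (-f y).toENNReal ∂Q).toReal : ℝ) :
      EReal) := by
  rw [expect, ← EReal.coe_ennreal_toReal h, ← EReal.coe_ennreal_toReal h', ← EReal.coe_sub,
    ← EReal.coe_neg, neg_sub]

instance isFiniteMeasure_outputLaw (σ : ℝ) (μ : Measure ℝ) [IsFiniteMeasure μ] :
    IsFiniteMeasure (outputLaw σ μ) := by
  unfold outputLaw; infer_instance

instance isFiniteMeasure_inputMarginal (φ : Fin k → ℝ → EReal) (Γ : Fin k → ℝ) (n : ℕ) :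
    IsFiniteMeasure (inputMarginal φ Γ n) := by
  unfold inputMarginal; infer_instance

/-- The single-letter lower bound for the normalised mutual information at a fixed block length. -/
theorem volumeRate_sub_le_blockCapacity (hσ : 0 < σ) (hφ : ∀ j, Measurable (φ j))
    (hφ_bot : ∀ j x, φ j x ≠ ⊥) (hθ : θ ∈ posVec k) {n : ℕ}
    (h0 : 0 < volume (inputSet φ Γ (n + 1))) (h1 : volume (inputSet φ Γ (n + 1)) < ∞) :
    volumeRate φ Γ (n + 1)
        - ((1 / 2 * Real.log (2 * Real.pi * Real.exp 1 * σ ^ 2) : ℝ) : EReal)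
        - (((∑ j, θ j * Γ j : ℝ) : EReal)
          + expect (outputLaw σ (inputMarginal φ Γ n)) fun y => ENNReal.log (zeta σ φ θ y))
      ≤ (blockCapacity σ φ Γ (n + 1) : EReal) := by
  set Q := outputLaw σ (inputMarginal φ Γ n)
  set ℓ : ℝ → EReal := fun y => ENNReal.log (zeta σ φ θ y)
  have hℓ : Measurable ℓ := (measurable_zeta hσ hφ).ennreal_log
  have ha : Measurable fun y => (ℓ y).toENNReal := hℓ.ereal_toENNReal
  have hb : Measurable fun y => (-ℓ y).toENNReal := hℓ.neg.ereal_toENNReal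
  set I := mutualInfo (channelJoint σ (n + 1)
    (ProbabilityTheory.cond volume (inputSet φ Γ (n + 1)))) with hI
  have hIC : I / ((n + 1 : ℕ) : ℝ≥0∞) ≤ blockCapacity σ φ Γ (n + 1) := by
    refine le_iSup_of_le (ProbabilityTheory.cond volume (inputSet φ Γ (n + 1)))
      (le_iSup_of_le (cond_isProbabilityMeasure_of_finite h0.ne' h1.ne) (le_iSup_of_le ?_ le_rfl))
    simp [cond_apply (measurableSet_inputSet hφ Γ (n + 1))]
  refine le_trans ?_ (EReal.coe_ennreal_le_coe_ennreal_iff.2 hIC)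
  -- If the positive part is not integrable, the expectation is `⊤` and the left side is `⊥`.
  by_cases hA : ∫⁻ y, (ℓ y).toENNReal ∂Q = ∞
  · simp [expect_eq_top hA]
  by_cases hItop : I = ∞
  · rw [hItop, ENNReal.top_div_of_ne_top (ENNReal.natCast_ne_top _)]
    simp
  set c := 1 / 2 * Real.log (2 * Real.pi * Real.exp 1 * σ ^ 2)
  set V := Real.log (volume (inputSet φ Γ (n + 1))).toReal
  set s := ∑ j, θ j * Γ j
  set A := ∫⁻ y, (ℓ y).toENNReal ∂Q
  set N : ℝ := ((n + 1 : ℕ) : ℝ)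
  have hN : 0 < N := by simp only [N]; positivity
  have hfin : ∀ᵐ y ∂Q, zeta σ φ θ y ≠ ∞ := by
    filter_upwards [ae_lt_top ha hA] with y hy htop
    simp [ℓ, htop] at hy
  -- The right side does not depend on `M`, so letting `M → ∞` shows that the whole negative part is
  -- integrable and obeys the same bound.
  have hM : ∀ M : ℕ, (∫⁻ y, min (-ℓ y).toENNReal M ∂Q).toReal ≤
      I.toReal / N - (V / N - c - s - A.toReal) := fun M => by
    have hb' : ∫⁻ y, min (-ℓ y).toENNReal M ∂Q ≠ ∞ :=
      lintegral_min_ne_top _ (ENNReal.natCast_ne_top M)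
    have hbm := hb.min (measurable_const (a := (M : ℝ≥0∞)))
    have key := ofReal_le_mutualInfo (h := fun y => (ℓ y).toENNReal.toReal
        - (min (-ℓ y).toENNReal M).toReal) hσ hφ hφ_bot hθ h0 h1
      (ha.ennreal_toReal.sub hbm.ennreal_toReal)
      (integrable_toReal_sub_toReal ha hbm hA hb')
      (hfin.mono fun y hy => le_exp_truncated_log hy)
    rw [integral_toReal_sub_toReal ha hbm hA hb', ENNReal.ofReal_le_iff_le_toReal hItop] at key
    have : (V - N * s + N * (-c - (A.toReal - (∫⁻ y, min (-ℓ y).toENNReal M ∂Q).toReal))) / N ≤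
        I.toReal / N := div_le_div_of_nonneg_right key hN.le
    have e : (V - N * s + N * (-c - (A.toReal - (∫⁻ y, min (-ℓ y).toENNReal M ∂Q).toReal))) / N =
        V / N - s - c - A.toReal + (∫⁻ y, min (-ℓ y).toENNReal M ∂Q).toReal := by
      field_simp; ring
    linarith
  set K := I.toReal / N - (V / N - c - s - A.toReal)
  have hK : 0 ≤ K := ENNReal.toReal_nonneg.trans (hM 0)
  have hB : ∫⁻ y, (-ℓ y).toENNReal ∂Q ≤ ENNReal.ofReal K :=
    le_of_tendsto (tendsto_lintegral_min_natCast hb) (Eventually.of_forall fun M =>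
      (ENNReal.le_ofReal_iff_toReal_le
        (lintegral_min_ne_top _ (ENNReal.natCast_ne_top M)) hK).2 (hM M))
  have hBtop := (hB.trans_lt ENNReal.ofReal_lt_top).ne
  have hBK := (ENNReal.le_ofReal_iff_toReal_le hBtop hK).1 hB
  have hIdiv : ((I / ((n + 1 : ℕ) : ℝ≥0∞) : ℝ≥0∞) : EReal) = ((I.toReal / N : ℝ) : EReal) := by
    rw [← EReal.coe_ennreal_toReal (ENNReal.div_ne_top hItop (by simp)), ENNReal.toReal_div,
      ENNReal.toReal_natCast]
  rw [hIdiv, volumeRate_eq_coe h0 h1, expect_eq_coe hA hBtop, ← EReal.coe_sub, ← EReal.coe_add,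
    ← EReal.coe_sub, EReal.coe_le_coe_iff]
  change V / N - c - (s + (A.toReal - _)) ≤ _
  simp only [K] at hBK
  linarith

/-! ### Passage to the limit in the block length -/

/-- Passing to the limit in a sequence of lower bounds `u - c - (s + e) ≤ w`. -/
theorem sub_le_liminf_of_tendsto {u e w : ℕ → EReal} {v L : EReal} {c s : ℝ}
    (hu : Tendsto u atTop (𝓝 v)) (he : limsup e atTop ≤ L)
    (h : ∀ᶠ n in atTop, u n - (c : EReal) - ((s : EReal) + e n) ≤ w n) :
    v - (c : EReal) - ((s : EReal) + L) ≤ liminf w atTop := by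
  -- Rewritten as a sum, the bound is covered by superadditivity of `liminf`; the convention `⊤ + ⊥
  -- = ⊥` takes care of the indeterminate cases.
  have alg : ∀ x y : EReal, x - (c : EReal) - ((s : EReal) + y) = x + (((-c - s : ℝ) : EReal) + -y) := by
    intro x y
    rw [sub_eq_add_neg, sub_eq_add_neg, EReal.neg_add (.inl (EReal.coe_ne_bot s))
      (.inl (EReal.coe_ne_top s)), sub_eq_add_neg, EReal.coe_sub, EReal.coe_neg, sub_eq_add_neg]
    simp only [add_assoc]
  calc v - (c : EReal) - ((s : EReal) + L) = v + (((-c - s : ℝ) : EReal) + -L) := alg v L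
    _ ≤ liminf u atTop + (liminf (fun _ : ℕ => ((-c - s : ℝ) : EReal)) atTop
          + liminf (-e) atTop) := by
        rw [hu.liminf_eq, liminf_const, EReal.liminf_neg]
        gcongr
        exact EReal.neg_le_neg_iff.2 he
    _ ≤ liminf u atTop + liminf ((fun _ : ℕ => ((-c - s : ℝ) : EReal)) + -e) atTop := by
        gcongr; exact EReal.le_liminf_add
    _ ≤ liminf (u + ((fun _ : ℕ => ((-c - s : ℝ) : EReal)) + -e)) atTop := EReal.le_liminf_add
    _ ≤ liminf w atTop := by
        refine liminf_le_liminf (h.mono fun n hn => ?_)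
        rw [alg] at hn
        exact hn

/-- For finite `C`, each inequality can be rearranged to `a - C ≤ f i`, which passes to the infimum
even in the presence of infinite values; for `C = ∞` nothing is claimed. -/
theorem sub_iInf_le {ι : Type*} {P : Set ι} {f : ι → EReal} {a : EReal} {C : ℝ≥0∞}
    (h : ∀ i ∈ P, a - f i ≤ C) : a - ⨅ i ∈ P, f i ≤ C := by
  rcases eq_or_ne C ∞ with rfl | hC
  · simp
  have hC' : (C : EReal) ≠ ⊤ := by simpa using hC
  have hCb : (C : EReal) ≠ ⊥ := EReal.coe_ennreal_ne_bot C
  lift C to ℝ≥0 using hC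
  rw [EReal.sub_le_iff_le_add (.inr hC') (.inr hCb), add_comm,
    ← EReal.sub_le_iff_le_add (.inl hCb) (.inl hC')]
  refine le_iInf₂ fun i hi => ?_
  rw [EReal.sub_le_iff_le_add (.inl hCb) (.inl hC'), add_comm,
    ← EReal.sub_le_iff_le_add (.inr hC') (.inr hCb)]
  exact h i hi

/-- The embedding into `EReal` is monotone and continuous, so it commutes with `liminf`. The shift
matches `inputMarginal`, whose index `n` refers to block length `n + 1`. -/
theorem coe_capacity (σ : ℝ) (φ : Fin k → ℝ → EReal) (Γ : Fin k → ℝ) :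
    (capacity σ φ Γ : EReal) =
      liminf (fun n => (blockCapacity σ φ Γ (n + 1) : EReal)) atTop := by
  rw [liminf_nat_add (fun n => (blockCapacity σ φ Γ n : EReal)) 1, capacity]
  exact Monotone.map_liminf_of_continuousAt (f := ((↑) : ℝ≥0∞ → EReal))
    (fun x y h => EReal.coe_ennreal_le_coe_ennreal_iff.2 h) _
    continuous_coe_ennreal_ereal.continuousAt

/-- The capacity bound for a fixed multiplier, given an asymptotic upper bound for
the expected logarithm of `ζ_θ`. -/
theorem volumeExponent_sub_le_capacity (hσ : 0 < σ) (hφ : ∀ j, Measurable (φ j))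
    (hφ_bot : ∀ j x, φ j x ≠ ⊥) (hθ : θ ∈ posVec k)
    (hvol : ∀ᶠ n in atTop, 0 < volume (inputSet φ Γ n) ∧ volume (inputSet φ Γ n) < ∞)
    {L : EReal}
    (hL : limsup (fun n => expect (outputLaw σ (inputMarginal φ Γ n))
      fun y => ENNReal.log (zeta σ φ θ y)) atTop ≤ L) :
    volumeExponent φ Γ - ((1 / 2 * Real.log (2 * Real.pi * Real.exp 1 * σ ^ 2) : ℝ) : EReal)
      - (((∑ j, θ j * Γ j : ℝ) : EReal) + L) ≤ (capacity σ φ Γ : EReal) := by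
  rw [coe_capacity]
  refine sub_le_liminf_of_tendsto
    ((tendsto_volumeRate hφ hvol).1.comp (tendsto_add_atTop_nat 1)) hL ?_
  filter_upwards [(tendsto_add_atTop_nat 1).eventually hvol] with n hn
  exact volumeRate_sub_le_blockCapacity hσ hφ hφ_bot hθ hn.1 hn.2

/-! ### Gaussian smoothing and semicontinuity of the expectation -/

/-- Convolution with a Gaussian density turns bounded measurable functions into continuous ones. -/
theorem continuous_integral_gaussianPDFReal {v : ℝ≥0} (hv : v ≠ 0) {g : ℝ → ℝ} (hg : Measurable g)
    {C : ℝ} (hC : ∀ y, |g y| ≤ C) : Continuous fun x => ∫ y, gaussianPDFReal x v y * g y := by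
  have hv' : (0 : ℝ) < v := by positivity
  have hC0 : 0 ≤ C := (abs_nonneg _).trans (hC 0)
  refine continuous_iff_continuousAt.2 fun x₀ => ?_
  -- The dominating function comes from `(y - x₀)² ≤ 2(y - x)² + 2(x - x₀)²` with `|x - x₀| ≤ 1`.
  refine continuousAt_of_dominated (bound := fun y =>
    (Real.sqrt (2 * Real.pi * v))⁻¹ * Real.exp (1 / (2 * v))
      * Real.exp (-(1 / (4 * v)) * (y - x₀) ^ 2) * C)
    (Eventually.of_forall fun x =>
      ((measurable_gaussianPDFReal x v).mul hg).aestronglyMeasurable) ?_ ?_ ?_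
  · filter_upwards [Metric.ball_mem_nhds x₀ one_pos] with x hx
    refine ae_of_all _ fun y => ?_
    rw [Real.norm_eq_abs, abs_mul, abs_of_nonneg (gaussianPDFReal_nonneg _ _ _)]
    refine mul_le_mul ?_ (hC y) (abs_nonneg _) (by positivity)
    rw [gaussianPDFReal, mul_assoc _ (Real.exp _), ← Real.exp_add]
    gcongr
    have hx2 : (x - x₀) ^ 2 ≤ 1 := by
      rw [Metric.mem_ball, Real.dist_eq] at hx
      rw [sq_le_one_iff_abs_le_one]; exact hx.le
    have e : 1 / (2 * (v : ℝ)) + -(1 / (4 * v)) * (y - x₀) ^ 2 - -(y - x) ^ 2 / (2 * v) =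
        (2 + 2 * (y - x) ^ 2 - (y - x₀) ^ 2) / (4 * v) := by field_simp; ring
    rw [← sub_nonneg, e]
    refine div_nonneg ?_ (by positivity)
    nlinarith [sq_nonneg ((y - x) - (x - x₀))]
  · refine Integrable.mul_const (Integrable.const_mul ?_ _) _
    exact (integrable_exp_neg_mul_sq (b := 1 / (4 * (v : ℝ))) (by positivity)).comp_sub_right x₀
  · refine ae_of_all _ fun y => ContinuousAt.mul ?_ continuousAt_const
    unfold gaussianPDFReal
    fun_prop

/-- Given the input `x`, the output is Gaussian with mean `x`, so the inner integral is the smoothed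
version of `g`. -/
theorem integral_outputLaw (hσ : 0 < σ) (μ : Measure ℝ) [IsFiniteMeasure μ] {g : ℝ → ℝ}
    (hg : Measurable g) {C : ℝ} (hC : ∀ y, |g y| ≤ C) :
    ∫ y, g y ∂outputLaw σ μ =
      ∫ x, (∫ y, gaussianPDFReal x (Real.toNNReal (σ ^ 2)) y * g y) ∂μ := by
  have hv : Real.toNNReal (σ ^ 2) ≠ 0 := by simpa using hσ.ne'
  have hint : Integrable (fun p : ℝ × ℝ => g (p.1 + p.2))
      (μ.prod (gaussianReal 0 (Real.toNNReal (σ ^ 2)))) :=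
    Integrable.of_bound (hg.comp (by fun_prop)).aestronglyMeasurable C (ae_of_all _ fun p => hC _)
  rw [outputLaw, integral_map (by fun_prop) hg.aestronglyMeasurable, integral_prod _ hint]
  refine integral_congr_ae (ae_of_all _ fun x => ?_)
  have h := integral_gaussianReal_eq_integral_smul (μ := x) hv (f := g)
  have e := gaussianReal_map_const_add (μ := 0) (v := Real.toNNReal (σ ^ 2)) x
  rw [zero_add] at e
  rw [← e, integral_map (by fun_prop : AEMeasurable (fun z : ℝ => x + z) _) hg.aestronglyMeasurable] at h
  exact h

/-- If the input laws converge weakly then, thanks to the Gaussian noise, the output laws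
converge against every bounded measurable function. -/
theorem tendsto_integral_outputLaw (hσ : 0 < σ) {μ : Measure ℝ} [IsFiniteMeasure μ]
    (hμ : IsAsymptoticMarginal φ Γ μ) {g : ℝ → ℝ} (hg : Measurable g) {C : ℝ}
    (hC : ∀ y, |g y| ≤ C) :
    Tendsto (fun n => ∫ y, g y ∂outputLaw σ (inputMarginal φ Γ n)) atTop
      (𝓝 (∫ y, g y ∂outputLaw σ μ)) := by
  have hv : Real.toNNReal (σ ^ 2) ≠ 0 := by simpa using hσ.ne'
  have hbd : ∀ x, ‖∫ y, gaussianPDFReal x (Real.toNNReal (σ ^ 2)) y * g y‖ ≤ C := fun x => by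
    refine (norm_integral_le_of_norm_le
      ((integrable_gaussianPDFReal x (Real.toNNReal (σ ^ 2))).mul_const C)
      (ae_of_all _ fun y => ?_)).trans_eq ?_
    · rw [norm_mul, Real.norm_of_nonneg (gaussianPDFReal_nonneg _ _ _)]
      exact mul_le_mul_of_nonneg_left (hC y) (gaussianPDFReal_nonneg _ _ _)
    · rw [integral_mul_const, integral_gaussianPDFReal_eq_one x hv, one_mul]
  simp_rw [integral_outputLaw hσ _ hg hC]
  exact hμ (BoundedContinuousFunction.ofNormedAddCommGroup _
    (continuous_integral_gaussianPDFReal hv hg hC) C hbd)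

theorem toENNReal_le_min_add (x : EReal) (K : ℝ) :
    x.toENNReal ≤ min x.toENNReal (ENNReal.ofReal K) + (x - (K : EReal)).toENNReal := by
  rcases le_total x.toENNReal (ENNReal.ofReal K) with h | h
  · rw [min_eq_left h]; exact le_self_add
  · rw [min_eq_right h, ← EReal.real_coe_toENNReal]
    refine le_trans (EReal.toENNReal_le_toENNReal ?_) EReal.toENNReal_add_le
    rw [add_comm, EReal.sub_add_cancel]

/-- Upper semicontinuity of the extended expectation along the output laws. -/
theorem limsup_expect_le (hσ : 0 < σ) {μ : Measure ℝ} [IsFiniteMeasure μ]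
    (hμ : IsAsymptoticMarginal φ Γ μ) {f : ℝ → EReal} (hf : Measurable f)
    (hui : AsympUnifIntegrable (fun n => outputLaw σ (inputMarginal φ Γ n)) f) :
    limsup (fun n => expect (outputLaw σ (inputMarginal φ Γ n)) f) atTop ≤
      expect (outputLaw σ μ) f := by
  set Q := outputLaw σ μ
  set P := fun n => outputLaw σ (inputMarginal φ Γ n)
  have ha : Measurable fun y => (f y).toENNReal := hf.ereal_toENNReal
  have hb : Measurable fun y => (-f y).toENNReal := hf.neg.ereal_toENNReal
  by_cases hA : ∫⁻ y, (f y).toENNReal ∂Q = ∞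
  · rw [expect_eq_top hA]; exact le_top
  refine EReal.le_of_forall_lt_iff_le.1 fun r hr => ?_
  set A := ∫⁻ y, (f y).toENNReal ∂Q
  -- The negative part may have infinite integral; a high enough truncation already brings the
  -- expectation below `r`.
  obtain ⟨M, hM⟩ : ∃ M : ℕ, A.toReal - (∫⁻ y, min (-f y).toENNReal M ∂Q).toReal < r := by
    have hlt : ((A.toReal - r : ℝ) : EReal) < ((∫⁻ y, (-f y).toENNReal ∂Q : ℝ≥0∞) : EReal) := by
      rw [expect, ← EReal.coe_ennreal_toReal hA, EReal.neg_lt_comm] at hr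
      have := (EReal.lt_sub_iff_add_lt (.inl (EReal.coe_ne_bot _))
        (.inl (EReal.coe_ne_top _))).1 hr
      rw [← EReal.coe_neg, ← EReal.coe_add] at this
      convert this using 2
      ring
    have ht := (continuous_coe_ennreal_ereal.tendsto _).comp
      (tendsto_lintegral_min_natCast (Q := Q) hb)
    obtain ⟨M, hM⟩ := (ht.eventually (lt_mem_nhds hlt)).exists
    refine ⟨M, ?_⟩
    rw [Function.comp_apply, ← EReal.coe_ennreal_toReal
      (lintegral_min_ne_top _ (ENNReal.natCast_ne_top M)), EReal.coe_lt_coe_iff] at hM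
    linarith
  set B := ∫⁻ y, min (-f y).toENNReal M ∂Q
  -- Half of the slack `δ` absorbs the tail of the positive part above `K`, the other half the
  -- convergence of the truncated expectations.
  set δ := r - (A.toReal - B.toReal) with hδ
  have hδ0 : 0 < δ := by linarith
  obtain ⟨K, hK⟩ := hui (ENNReal.ofReal (δ / 2)) (by simpa using hδ0)
  set a' : ℝ → ℝ≥0∞ := fun y => min (f y).toENNReal (ENNReal.ofReal K)
  set b' : ℝ → ℝ≥0∞ := fun y => min (-f y).toENNReal M
  have ha' : Measurable a' := ha.min measurable_const
  have hb' : Measurable b' := hb.min measurable_const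
  have hfa : ∀ (ν : Measure ℝ) [IsFiniteMeasure ν], ∫⁻ y, a' y ∂ν ≠ ∞ := fun ν _ =>
    lintegral_min_ne_top _ ENNReal.ofReal_ne_top
  have hfb : ∀ (ν : Measure ℝ) [IsFiniteMeasure ν], ∫⁻ y, b' y ∂ν ≠ ∞ := fun ν _ =>
    lintegral_min_ne_top _ (ENNReal.natCast_ne_top M)
  have hlim := tendsto_integral_outputLaw hσ hμ (g := fun y => (a' y).toReal - (b' y).toReal)
    (ha'.ennreal_toReal.sub hb'.ennreal_toReal) (C := (ENNReal.ofReal K).toReal + M) fun y => by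
      have h1 : (a' y).toReal ≤ (ENNReal.ofReal K).toReal :=
        ENNReal.toReal_mono ENNReal.ofReal_ne_top (min_le_right _ _)
      have h2 : (b' y).toReal ≤ M := by
        simpa using ENNReal.toReal_mono (ENNReal.natCast_ne_top M)
          (min_le_right (-f y).toENNReal (M : ℝ≥0∞))
      have h3 : 0 ≤ (a' y).toReal := ENNReal.toReal_nonneg
      have h4 : 0 ≤ (b' y).toReal := ENNReal.toReal_nonneg
      rw [abs_le]; constructor <;> linarith
  have hlt : ∫ y, ((a' y).toReal - (b' y).toReal) ∂Q < r - δ / 2 := by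
    rw [integral_toReal_sub_toReal ha' hb' (hfa Q) (hfb Q)]
    have : (∫⁻ y, a' y ∂Q).toReal ≤ A.toReal :=
      ENNReal.toReal_mono hA (lintegral_mono fun y => min_le_left _ _)
    linarith
  refine limsup_le_of_le (by isBoundedDefault) ?_
  filter_upwards [hK, hlim.eventually (gt_mem_nhds hlt)] with n hn hn'
  change ∫ y, ((a' y).toReal - (b' y).toReal) ∂P n < _ at hn'
  rw [integral_toReal_sub_toReal ha' hb' (hfa (P n)) (hfb (P n))] at hn'
  have hle : ∫⁻ y, (f y).toENNReal ∂P n ≤ ∫⁻ y, a' y ∂P n + ENNReal.ofReal (δ / 2) :=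
    calc ∫⁻ y, (f y).toENNReal ∂P n
        ≤ ∫⁻ y, (a' y + (f y - (K : EReal)).toENNReal) ∂P n :=
          lintegral_mono fun y => toENNReal_le_min_add (f y) K
      _ = ∫⁻ y, a' y ∂P n + ∫⁻ y, (f y - (K : EReal)).toENNReal ∂P n :=
          lintegral_add_left ha' _
      _ ≤ _ := by gcongr
  have hsum : ∫⁻ y, a' y ∂P n + ENNReal.ofReal (δ / 2) ≠ ∞ :=
    ENNReal.add_ne_top.2 ⟨hfa (P n), ENNReal.ofReal_ne_top⟩
  have hAn : ∫⁻ y, (f y).toENNReal ∂P n ≠ ∞ := (hle.trans_lt hsum.lt_top).ne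
  have hAn' := ENNReal.toReal_mono hsum hle
  rw [ENNReal.toReal_add (hfa (P n)) ENNReal.ofReal_ne_top,
    ENNReal.toReal_ofReal (by positivity)] at hAn'
  have hBn : ∫⁻ y, b' y ∂P n ≤ ∫⁻ y, (-f y).toENNReal ∂P n :=
    lintegral_mono fun y => min_le_left _ _
  have hBn' : (((∫⁻ y, b' y ∂P n).toReal : ℝ) : EReal) ≤
      ((∫⁻ y, (-f y).toENNReal ∂P n : ℝ≥0∞) : EReal) := by
    rw [EReal.coe_ennreal_toReal (hfb (P n))]
    exact EReal.coe_ennreal_le_coe_ennreal_iff.2 hBn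
  change expect (P n) f ≤ r
  rw [expect, ← EReal.coe_ennreal_toReal hAn]
  calc _ ≤ -((((∫⁻ y, b' y ∂P n).toReal : ℝ) : EReal)
        - ((∫⁻ y, (f y).toENNReal ∂P n).toReal : EReal)) :=
        EReal.neg_le_neg_iff.2 (EReal.sub_le_sub hBn' le_rfl)
    _ ≤ (r : EReal) := by
        rw [← EReal.coe_sub, ← EReal.coe_neg, EReal.coe_le_coe_iff]
        linarith

end GaussCap

theorem mainTheorem3 {k : ℕ} (σ : ℝ) (hσ : 0 < σ)
    (φ : Fin k → ℝ → EReal) (hφ : ∀ j, Measurable (φ j)) (hφ_bot : ∀ j x, φ j x ≠ ⊥)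
    (Γ : Fin k → ℝ)
    (hvol : ∀ᶠ n in atTop, 0 < volume (GaussCap.inputSet φ Γ n) ∧
      volume (GaussCap.inputSet φ Γ n) < ∞) :
    Tendsto (fun n => GaussCap.volumeRate φ Γ n) atTop (𝓝 (GaussCap.volumeExponent φ Γ)) ∧
    ⊥ < GaussCap.volumeExponent φ Γ ∧
    GaussCap.volumeExponent φ Γ
        - ((1 / 2 * Real.log (2 * Real.pi * Real.exp 1 * σ ^ 2) : ℝ) : EReal)
        - (⨅ θ ∈ GaussCap.posVec k, (((∑ j, θ j * Γ j : ℝ) : EReal)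
            + limsup (fun n =>
                GaussCap.expect (GaussCap.outputLaw σ (GaussCap.inputMarginal φ Γ n))
                  (fun y => ENNReal.log (GaussCap.zeta σ φ θ y))) atTop))
      ≤ (GaussCap.capacity σ φ Γ : EReal) ∧
    ∀ μ : Measure ℝ, IsProbabilityMeasure μ → GaussCap.IsAsymptoticMarginal φ Γ μ →
      GaussCap.volumeExponent φ Γ
          - ((1 / 2 * Real.log (2 * Real.pi * Real.exp 1 * σ ^ 2) : ℝ) : EReal)
          - (⨅ θ ∈ GaussCap.admissible σ φ Γ, (((∑ j, θ j * Γ j : ℝ) : EReal)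
              + GaussCap.expect (GaussCap.outputLaw σ μ)
                  (fun y => ENNReal.log (GaussCap.zeta σ φ θ y))))
        ≤ (GaussCap.capacity σ φ Γ : EReal) := by

  obtain ⟨hlim, hbot⟩ := GaussCap.tendsto_volumeRate hφ hvol
  refine ⟨hlim, hbot, ?_, fun μ _ hμ => ?_⟩
  · exact GaussCap.sub_iInf_le fun θ hθ =>
      GaussCap.volumeExponent_sub_le_capacity hσ hφ hφ_bot hθ hvol le_rfl
  · exact GaussCap.sub_iInf_le fun θ hθ =>
      GaussCap.volumeExponent_sub_le_capacity hσ hφ hφ_bot hθ.1 hvol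
        (GaussCap.limsup_expect_le hσ hμ (GaussCap.measurable_zeta hσ hφ).ennreal_log hθ.2)
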